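/- Let $G$ be a second countable, locally compact Hausdorff group with a right Haar measure $\lambda$, and let $\Phi:\mathbb R\to\mathbb R$ be a Young function: $\Phi$ is continuous, even and convex, $\Phi(0)=0$, $\Phi(t)>0$ for $t>0$, and $\lim_{t\to\infty}\Phi(t)=\infty$. Assume that $\Phi$ is $\Delta_2$-regular, i.e. there are $M,t_0>0$ with $\Phi(2t)\le M\Phi(t)$ for all $t\ge t_0$ if $G$ is compact, and there is $M>0$ with $\Phi(2t)\le M\Phi(t)$ for all $t>0$ if $G$ is noncompact. Let $L^\Phi(G)$ be the Orlicz space of Borel functions $f:G\to\mathbb C$ (modulo $\lambda$-a.e. equality) with $\int_G\Phi(\alpha|f|)\,d\lambda<\infty$ for some $\alpha>0$, with the Luxemburg norm $N_\Phi(f)=\inf\{k>0:\int_G\Phi(|f|/k)\,d\lambda\le1\}$. Let $a\in G$ be aperiodic, i.e. the closed subgroup generated by $a$ is not compact. Let $w:G\to(0,\infty)$ be a bounded continuous function with $w^{-1}\in L^\infty(G)$, and let $T_{a,w}:L^\Phi(G)\to L^\Phi(G)$ be the weighted translation $(T_{a,w}f)(x)=w(x)f(xa^{-1})$. For $n\in\mathbb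 N$ put $$\varphi_n(x)=\prod_{j=1}^{n}w(xa^{j}),\qquad \widetilde\varphi_n(x)=\Big(\prod_{j=0}^{n-1}w(xa^{-j})\Big)^{-1}\qquad(x\in G).$$ Then the following conditions are equivalent. (i) $T_{a,w}$ is recurrent: for every nonempty open $U\subset L^\Phi(G)$ there is an integer $n\ge1$ with $U\cap T_{a,w}^{-n}U\neq\emptyset$. (ii) For every compact $K\subset G$ with $\lambda(K)>0$ there are a sequence of Borel sets $E_k\subset K$ with $\lim_{k\to\infty}\lambda(E_k)=\lambda(K)$ and a strictly increasing sequence $(n_k)$ of natural numbers such that $$\lim_{k\to\infty}\ \sup_{x\in E_k}\varphi_{n_k}(x)=\lim_{k\to\infty}\ \sup_{x\in E_k}\widetilde\varphi_{n_k}(x)=0.$$ Moreover, $T_{a,w}$ is recurrent if and only if it is topologically transitive, i.e. for all nonempty open $U,V\subset L^\Phi(G)$ there is an integer $n\ge1$ with $T_{a,w}^nU\cap V\neq\emptyset$. -/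

import Mathlib

open Filter Topology MeasureTheory Set
open scoped ENNReal

noncomputable section

/-- A Young function: a continuous, even, convex function `Φ : ℝ → ℝ` with `Φ 0 = 0`,
`Φ t > 0` for `t > 0`, and `Φ t → ∞` as `t → ∞`. -/
structure YoungFunction where
  toFun : ℝ → ℝ
  continuous' : Continuous toFun
  even' : ∀ t, toFun (-t) = toFun t
  convex' : ConvexOn ℝ univ toFun
  map_zero' : toFun 0 = 0
  pos' : ∀ t, 0 < t → 0 < toFun t
  tendsto' : Tendsto toFun atTop atTop

namespace YoungFunction

instance : CoeFun YoungFunction (fun _ => ℝ → ℝ) := ⟨toFun⟩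

/-- `Φ` is `Δ₂`-regular relative to `G`: the doubling inequality `Φ (2 t) ≤ M Φ t` holds for all
large `t` if `G` is compact, and for all `t > 0` if `G` is noncompact. -/
def IsDelta2Regular (Φ : YoungFunction) (G : Type*) [TopologicalSpace G] : Prop :=
  (CompactSpace G → ∃ M > 0, ∃ t₀ > 0, ∀ t ≥ t₀, Φ (2 * t) ≤ M * Φ t) ∧
  (NoncompactSpace G → ∃ M > 0, ∀ t > 0, Φ (2 * t) ≤ M * Φ t)

theorem nonneg (Φ : YoungFunction) {t : ℝ} (ht : 0 ≤ t) : 0 ≤ Φ t := by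
  rcases ht.eq_or_lt with h | h
  · rw [← h]; exact Φ.map_zero'.ge
  · exact (Φ.pos' t h).le

theorem map_mul_le (Φ : YoungFunction) {c t : ℝ} (hc : 0 ≤ c) (hc1 : c ≤ 1) :
    Φ (c * t) ≤ c * Φ t := by
  have h := Φ.convex'.2 (mem_univ t) (mem_univ 0) hc (sub_nonneg.2 hc1) (by ring)
  simpa [Φ.map_zero'] using h

theorem mono (Φ : YoungFunction) {s t : ℝ} (hs : 0 ≤ s) (hst : s ≤ t) : Φ s ≤ Φ t := by
  rcases (hs.trans hst).eq_or_lt with h | h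
  · rw [show s = t by linarith]
  · have h1 := Φ.map_mul_le (c := s / t) (t := t) (by positivity) ((div_le_one h).2 hst)
    rw [div_mul_cancel₀ _ h.ne'] at h1
    exact h1.trans (mul_le_of_le_one_left (Φ.nonneg h.le) ((div_le_one h).2 hst))

end YoungFunction

section Orlicz

variable {α : Type*} [MeasurableSpace α]

/-- The modular `∫ Φ(|f|) dμ`, with values in `[0, ∞]`. -/
def orliczModular (Φ : YoungFunction) (μ : Measure α) (f : α → ℝ) : ℝ≥0∞ :=
  ∫⁻ x, ENNReal.ofReal (Φ |f x|) ∂μ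

/-- The Luxemburg norm `N_Φ(f) = inf {k > 0 : ∫ Φ(|f| / k) dμ ≤ 1}`. -/
def luxemburgNorm (Φ : YoungFunction) (μ : Measure α) (f : α → ℂ) : ℝ :=
  sInf {k : ℝ | 0 < k ∧ orliczModular Φ μ (fun x => ‖f x‖ / k) ≤ 1}

theorem orliczModular_congr (Φ : YoungFunction) {μ : Measure α} {f g : α → ℝ} (h : f =ᵐ[μ] g) :
    orliczModular Φ μ f = orliczModular Φ μ g :=
  lintegral_congr_ae (h.mono fun x hx => by simp only [hx])

theorem orliczModular_mono (Φ : YoungFunction) {μ : Measure α} {f g : α → ℝ}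
    (h : ∀ᵐ x ∂μ, |f x| ≤ |g x|) : orliczModular Φ μ f ≤ orliczModular Φ μ g :=
  lintegral_mono_ae (h.mono fun x hx => ENNReal.ofReal_le_ofReal (Φ.mono (abs_nonneg _) hx))

theorem orliczModular_smul_le (Φ : YoungFunction) {μ : Measure α} {f : α → ℝ} {c : ℝ}
    (hc : 0 ≤ c) (hc1 : c ≤ 1) :
    orliczModular Φ μ (fun x => c * f x) ≤ ENNReal.ofReal c * orliczModular Φ μ f := by
  unfold orliczModular
  rw [← lintegral_const_mul' _ _ ENNReal.ofReal_ne_top]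
  refine lintegral_mono fun x => ?_
  rw [← ENNReal.ofReal_mul hc, abs_mul, abs_of_nonneg hc]
  exact ENNReal.ofReal_le_ofReal (Φ.map_mul_le hc hc1)

theorem orliczModular_convex (Φ : YoungFunction) {μ : Measure α} {f g : α → ℝ} {s t : ℝ}
    (hs : 0 ≤ s) (ht : 0 ≤ t) (hst : s + t = 1) (hf : AEMeasurable f μ) :
    orliczModular Φ μ (fun x => s * |f x| + t * |g x|) ≤
      ENNReal.ofReal s * orliczModular Φ μ f + ENNReal.ofReal t * orliczModular Φ μ g := by
  unfold orliczModular
  have hm : AEMeasurable (fun x => ENNReal.ofReal (Φ |f x|)) μ :=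
    (Φ.continuous'.measurable.comp_aemeasurable
      (continuous_abs.measurable.comp_aemeasurable hf)).ennreal_ofReal
  rw [← lintegral_const_mul' _ _ ENNReal.ofReal_ne_top,
    ← lintegral_const_mul' _ _ ENNReal.ofReal_ne_top, ← lintegral_add_left' (hm.const_mul _)]
  refine lintegral_mono fun x => ?_
  have h1 := Φ.nonneg (abs_nonneg (f x))
  have h2 := Φ.nonneg (abs_nonneg (g x))
  rw [← ENNReal.ofReal_mul hs, ← ENNReal.ofReal_mul ht,
    ← ENNReal.ofReal_add (mul_nonneg hs h1) (mul_nonneg ht h2),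
    abs_of_nonneg (by positivity : 0 ≤ s * |f x| + t * |g x|)]
  exact ENNReal.ofReal_le_ofReal (by
    simpa using Φ.convex'.2 (mem_univ |f x|) (mem_univ |g x|) hs ht hst)

/-- Membership in the Orlicz class `L^Φ`: `∫ Φ(c |f|) dμ < ∞` for some `c > 0`. -/
def MemOrlicz (Φ : YoungFunction) (μ : Measure α) (f : α → ℂ) : Prop :=
  ∃ c : ℝ, 0 < c ∧ orliczModular Φ μ (fun x => c * ‖f x‖) < ∞

theorem MemOrlicz.congr {Φ : YoungFunction} {μ : Measure α} {f g : α → ℂ} (hf : MemOrlicz Φ μ f)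
    (h : f =ᵐ[μ] g) : MemOrlicz Φ μ g := by
  obtain ⟨c, hc, hfc⟩ := hf
  refine ⟨c, hc, ?_⟩
  rwa [← orliczModular_congr Φ (f := fun x => c * ‖f x‖) (g := fun x => c * ‖g x‖)
    (h.mono fun x hx => by simp only [hx])]

theorem MemOrlicz.of_le {Φ : YoungFunction} {μ : Measure α} {f g : α → ℂ} {C : ℝ} (hC : 0 < C)
    (hf : MemOrlicz Φ μ f) (h : ∀ᵐ x ∂μ, ‖g x‖ ≤ C * ‖f x‖) : MemOrlicz Φ μ g := by
  obtain ⟨c, hc, hfc⟩ := hf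
  refine ⟨c / C, by positivity, lt_of_le_of_lt (orliczModular_mono Φ ?_) hfc⟩
  filter_upwards [h] with x hx
  rw [abs_of_nonneg (by positivity), abs_of_nonneg (by positivity)]
  calc c / C * ‖g x‖ ≤ c / C * (C * ‖f x‖) := by gcongr
    _ = c * ‖f x‖ := by field_simp

theorem MemOrlicz.add {Φ : YoungFunction} {μ : Measure α} {f g : α → ℂ}
    (hfm : AEStronglyMeasurable f μ) (hf : MemOrlicz Φ μ f) (hg : MemOrlicz Φ μ g) :
    MemOrlicz Φ μ (fun x => f x + g x) := by
  obtain ⟨c, hc, hfc⟩ := hf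
  obtain ⟨d, hd, hgd⟩ := hg
  have hm : 0 < min c d := lt_min hc hd
  refine ⟨min c d / 2, by positivity, ?_⟩
  have h1 := orliczModular_convex Φ (μ := μ) (f := fun x => c * ‖f x‖) (g := fun x => d * ‖g x‖)
    (s := 1 / 2) (t := 1 / 2) (by norm_num) (by norm_num) (by norm_num)
    (hfm.norm.aemeasurable.const_mul c)
  refine lt_of_le_of_lt ((orliczModular_mono Φ (ae_of_all _ fun x => ?_)).trans h1) ?_
  · rw [abs_of_nonneg (by positivity), abs_of_nonneg (by positivity), abs_of_nonneg (by positivity),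
      abs_of_nonneg (by positivity)]
    have h2 := norm_add_le (f x) (g x)
    have h3 : min c d * ‖f x‖ ≤ c * ‖f x‖ := by gcongr; exact min_le_left _ _
    have h4 : min c d * ‖g x‖ ≤ d * ‖g x‖ := by gcongr; exact min_le_right _ _
    have h5 : min c d * ‖f x + g x‖ ≤ min c d * (‖f x‖ + ‖g x‖) := by gcongr
    linarith
  · exact ENNReal.add_lt_top.2 ⟨ENNReal.mul_lt_top ENNReal.ofReal_lt_top hfc,
      ENNReal.mul_lt_top ENNReal.ofReal_lt_top hgd⟩

theorem MemOrlicz.exists_modular_le {Φ : YoungFunction} {μ : Measure α} {f : α → ℂ}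
    (hf : MemOrlicz Φ μ f) :
    {k : ℝ | 0 < k ∧ orliczModular Φ μ (fun x => ‖f x‖ / k) ≤ 1}.Nonempty := by
  obtain ⟨c, hc, hfc⟩ := hf
  set R := (orliczModular Φ μ (fun x => c * ‖f x‖)).toReal with hR
  have hR0 : 0 ≤ R := ENNReal.toReal_nonneg
  refine ⟨(1 + R) / c, by positivity, ?_⟩
  have h := orliczModular_smul_le Φ (μ := μ) (f := fun x => c * ‖f x‖) (c := 1 / (1 + R))
    (by positivity) (by rw [div_le_one (by positivity)]; linarith)
  have e : (fun x => ‖f x‖ / ((1 + R) / c)) = fun x => 1 / (1 + R) * (c * ‖f x‖) := by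
    funext x; field_simp
  rw [e]
  refine h.trans ?_
  rw [← ENNReal.ofReal_toReal hfc.ne, ← hR, ← ENNReal.ofReal_mul (by positivity)]
  refine ENNReal.ofReal_le_one.2 ?_
  rw [one_div_mul_eq_div, div_le_one (by positivity)]
  linarith

theorem luxemburgNorm_congr (Φ : YoungFunction) {μ : Measure α} {f g : α → ℂ} (h : f =ᵐ[μ] g) :
    luxemburgNorm Φ μ f = luxemburgNorm Φ μ g := by
  unfold luxemburgNorm
  congr 1
  ext k
  simp only [mem_ofPred_eq]
  rw [orliczModular_congr Φ (f := fun x => ‖f x‖ / k) (g := fun x => ‖g x‖ / k)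
    (h.mono fun x hx => by simp only [hx])]

theorem luxemburgNorm_nonneg (Φ : YoungFunction) (μ : Measure α) (f : α → ℂ) :
    0 ≤ luxemburgNorm Φ μ f :=
  Real.sInf_nonneg fun _ hk => hk.1.le

theorem luxemburgNorm_le (Φ : YoungFunction) {μ : Measure α} {f : α → ℂ} {k : ℝ} (hk : 0 < k)
    (h : orliczModular Φ μ (fun x => ‖f x‖ / k) ≤ 1) : luxemburgNorm Φ μ f ≤ k :=
  csInf_le ⟨0, fun _ hk => hk.1.le⟩ ⟨hk, h⟩

theorem MemOrlicz.modular_le_of_lt {Φ : YoungFunction} {μ : Measure α} {f : α → ℂ}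
    (hf : MemOrlicz Φ μ f) {k : ℝ} (hk : luxemburgNorm Φ μ f < k) :
    orliczModular Φ μ (fun x => ‖f x‖ / k) ≤ 1 := by
  obtain ⟨j, ⟨hj, hj1⟩, hjk⟩ := exists_lt_of_csInf_lt hf.exists_modular_le hk
  refine (orliczModular_mono Φ (ae_of_all _ fun x => ?_)).trans hj1
  have := hj.trans hjk
  rw [abs_of_nonneg (by positivity), abs_of_nonneg (by positivity)]
  gcongr

theorem MemOrlicz.luxemburgNorm_le_mul {Φ : YoungFunction} {μ : Measure α} {f g : α → ℂ} {C : ℝ}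
    (hC : 0 < C) (hf : MemOrlicz Φ μ f) (h : ∀ᵐ x ∂μ, ‖g x‖ ≤ C * ‖f x‖) :
    luxemburgNorm Φ μ g ≤ C * luxemburgNorm Φ μ f := by
  rw [← div_le_iff₀' hC]
  refine le_of_forall_gt_imp_ge_of_dense fun k hk => ?_
  have hk0 : 0 < k := (luxemburgNorm_nonneg Φ μ f).trans_lt hk
  rw [div_le_iff₀' hC]
  refine luxemburgNorm_le Φ (by positivity) ((orliczModular_mono Φ ?_).trans (hf.modular_le_of_lt hk))
  filter_upwards [h] with x hx
  rw [abs_of_nonneg (by positivity), abs_of_nonneg (by positivity), div_le_div_iff₀ (by positivity) hk0]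
  calc ‖g x‖ * k ≤ C * ‖f x‖ * k := by gcongr
    _ = ‖f x‖ * (C * k) := by ring

theorem MemOrlicz.luxemburgNorm_add_le {Φ : YoungFunction} {μ : Measure α} {f g : α → ℂ}
    (hfm : AEStronglyMeasurable f μ) (hf : MemOrlicz Φ μ f) (hg : MemOrlicz Φ μ g) :
    luxemburgNorm Φ μ (fun x => f x + g x) ≤ luxemburgNorm Φ μ f + luxemburgNorm Φ μ g := by
  refine le_of_forall_pos_le_add fun ε hε => ?_
  set j := luxemburgNorm Φ μ f + ε / 2 with hj
  set k := luxemburgNorm Φ μ g + ε / 2 with hk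
  have hj0 : 0 < j := add_pos_of_nonneg_of_pos (luxemburgNorm_nonneg Φ μ f) (by positivity)
  have hk0 : 0 < k := add_pos_of_nonneg_of_pos (luxemburgNorm_nonneg Φ μ g) (by positivity)
  have hj1 := hf.modular_le_of_lt (k := j) (by linarith)
  have hk1 := hg.modular_le_of_lt (k := k) (by linarith)
  have h1 := orliczModular_convex Φ (μ := μ) (f := fun x => ‖f x‖ / j) (g := fun x => ‖g x‖ / k)
    (s := j / (j + k)) (t := k / (j + k)) (by positivity) (by positivity) (by field_simp)
    (hfm.norm.aemeasurable.div_const j)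
  have h2 : luxemburgNorm Φ μ (fun x => f x + g x) ≤ j + k := by
    refine luxemburgNorm_le Φ (by positivity)
      (((orliczModular_mono Φ (ae_of_all _ fun x => ?_)).trans h1).trans ?_)
    · rw [abs_of_nonneg (by positivity), abs_of_nonneg (by positivity),
        abs_of_nonneg (by positivity), abs_of_nonneg (by positivity)]
      have e : j / (j + k) * (‖f x‖ / j) + k / (j + k) * (‖g x‖ / k)
          = (‖f x‖ + ‖g x‖) / (j + k) := by field_simp
      rw [e]
      gcongr
      exact norm_add_le _ _
    · calc _ ≤ ENNReal.ofReal (j / (j + k)) * 1 + ENNReal.ofReal (k / (j + k)) * 1 := by gcongr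
        _ = 1 := by
          rw [mul_one, mul_one, ← ENNReal.ofReal_add (by positivity) (by positivity),
            ← add_div, div_self (by positivity), ENNReal.ofReal_one]
  linarith

theorem MemOrlicz.ae_eq_zero {Φ : YoungFunction} {μ : Measure α} {f : α → ℂ}
    (hfm : AEStronglyMeasurable f μ) (hf : MemOrlicz Φ μ f) (h0 : luxemburgNorm Φ μ f = 0) :
    f =ᵐ[μ] 0 := by
  have key : ∀ ε : ℝ, 0 < ε → ε ≤ 1 →
      orliczModular Φ μ (fun x => ‖f x‖) ≤ ENNReal.ofReal ε := by
    intro ε hε hε1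
    have h1 := orliczModular_smul_le Φ (μ := μ) (f := fun x => ‖f x‖ / ε) hε.le hε1
    have h2 := hf.modular_le_of_lt (k := ε) (by linarith)
    have e : (fun x => ε * (‖f x‖ / ε)) = fun x => ‖f x‖ := by funext x; field_simp
    rw [e] at h1
    calc _ ≤ _ := h1
      _ ≤ ENNReal.ofReal ε * 1 := by gcongr
      _ = _ := mul_one _
  have hz : orliczModular Φ μ (fun x => ‖f x‖) = 0 := by
    refine le_antisymm (ENNReal.le_of_forall_pos_le_add fun ε hε _ => ?_) bot_le
    rw [zero_add]
    refine (key (min ε 1) (lt_min hε one_pos) (min_le_right _ _)).trans ?_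
    refine (ENNReal.ofReal_le_ofReal (min_le_left _ _)).trans ?_
    rw [ENNReal.ofReal_coe_nnreal]
  unfold orliczModular at hz
  have hm : AEMeasurable (fun x => ENNReal.ofReal (Φ |‖f x‖|)) μ :=
    (Φ.continuous'.measurable.comp_aemeasurable
      (continuous_abs.measurable.comp_aemeasurable hfm.norm.aemeasurable)).ennreal_ofReal
  rw [lintegral_eq_zero_iff' hm] at hz
  filter_upwards [hz] with x hx
  by_contra hne
  have : 0 < Φ |‖f x‖| := Φ.pos' _ (abs_pos.2 (norm_ne_zero_iff.2 hne))
  have hx' : ENNReal.ofReal (Φ |‖f x‖|) = 0 := hx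
  rw [ENNReal.ofReal_eq_zero] at hx'
  linarith

/-- The complex subspace of `μ`-a.e. classes of measurable functions belonging to `L^Φ`. -/
def orliczSubmodule (Φ : YoungFunction) (μ : Measure α) : Submodule ℂ (α →ₘ[μ] ℂ) where
  carrier := {f | MemOrlicz Φ μ f}
  zero_mem' := ⟨1, one_pos, by
    rw [orliczModular_congr Φ (g := fun _ => (0 : ℝ))
      ((AEEqFun.coeFn_zero (μ := μ) (β := ℂ)).mono fun x hx => by simp [hx])]
    simp [orliczModular, Φ.map_zero']⟩
  add_mem' {f g} hf hg := (hf.add f.aestronglyMeasurable hg).congr (AEEqFun.coeFn_add f g).symm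
  smul_mem' c f hf := hf.of_le (C := ‖c‖ + 1) (by positivity) (by
    filter_upwards [AEEqFun.coeFn_smul c f] with x hx
    rw [hx, Pi.smul_apply, norm_smul]
    gcongr
    linarith)

/-- The Orlicz space `L^Φ(μ)` of complex-valued functions (modulo a.e. equality), normed by the
Luxemburg norm. -/
def OrliczSpace (Φ : YoungFunction) (μ : Measure α) : Type _ := ↥(orliczSubmodule Φ μ)

namespace OrliczSpace

variable {Φ : YoungFunction} {μ : Measure α}

instance : AddCommGroup (OrliczSpace Φ μ) := inferInstanceAs (AddCommGroup (orliczSubmodule Φ μ))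

instance : Module ℂ (OrliczSpace Φ μ) := inferInstanceAs (Module ℂ (orliczSubmodule Φ μ))

/-- The underlying a.e. class. -/
def val (f : OrliczSpace Φ μ) : α →ₘ[μ] ℂ := Subtype.val f

/-- The class in `L^Φ(μ)` of a measurable function satisfying the integrability condition. -/
def mk (f : α → ℂ) (hfm : AEStronglyMeasurable f μ) (hf : MemOrlicz Φ μ f) : OrliczSpace Φ μ :=
  ⟨AEEqFun.mk f hfm, hf.congr (AEEqFun.coeFn_mk f hfm).symm⟩

theorem ext_ae {f g : OrliczSpace Φ μ} (h : f.val =ᵐ[μ] g.val) : f = g :=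
  Subtype.ext (AEEqFun.ext h)

theorem memOrlicz (f : OrliczSpace Φ μ) : MemOrlicz Φ μ f.val := Subtype.property f

theorem val_mk (f : α → ℂ) (hfm : AEStronglyMeasurable f μ) (hf : MemOrlicz Φ μ f) :
    (mk f hfm hf).val =ᵐ[μ] f := AEEqFun.coeFn_mk f hfm

theorem val_zero : (0 : OrliczSpace Φ μ).val =ᵐ[μ] 0 := AEEqFun.coeFn_zero

theorem val_add (f g : OrliczSpace Φ μ) : (f + g).val =ᵐ[μ] f.val + g.val :=
  AEEqFun.coeFn_add f.val g.val

theorem val_smul (c : ℂ) (f : OrliczSpace Φ μ) : (c • f).val =ᵐ[μ] c • ⇑f.val :=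
  AEEqFun.coeFn_smul c f.val

instance : Norm (OrliczSpace Φ μ) := ⟨fun f => luxemburgNorm Φ μ f.val⟩

theorem norm_def (f : OrliczSpace Φ μ) : ‖f‖ = luxemburgNorm Φ μ f.val := rfl

theorem norm_le_mul {C : ℝ} (hC : 0 < C) {f g : OrliczSpace Φ μ}
    (h : ∀ᵐ x ∂μ, ‖g.val x‖ ≤ C * ‖f.val x‖) : ‖g‖ ≤ C * ‖f‖ :=
  f.memOrlicz.luxemburgNorm_le_mul hC h

theorem core : NormedSpace.Core ℂ (OrliczSpace Φ μ) where
  norm_nonneg f := luxemburgNorm_nonneg Φ μ f.val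
  norm_smul c f := by
    have hz : ‖(0 : OrliczSpace Φ μ)‖ = 0 := by
      refine le_antisymm ?_ (luxemburgNorm_nonneg Φ μ _)
      have h := norm_le_mul (C := 1 / 2) (by norm_num) (f := (0 : OrliczSpace Φ μ))
        (g := (0 : OrliczSpace Φ μ)) (by filter_upwards [val_zero] with x hx; rw [hx]; simp)
      linarith
    rcases eq_or_ne c 0 with rfl | hc
    · simp [hz]
    have hc' : 0 < ‖c‖ := norm_pos_iff.2 hc
    refine le_antisymm (norm_le_mul hc' ?_) ?_
    · filter_upwards [val_smul c f] with x hx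
      rw [hx, Pi.smul_apply, norm_smul]
    · have h := norm_le_mul (inv_pos.2 hc') (f := c • f) (g := f) (by
        filter_upwards [val_smul c f] with x hx
        rw [hx, Pi.smul_apply, norm_smul, inv_mul_cancel_left₀ hc'.ne'])
      rwa [le_inv_mul_iff₀ hc'] at h
  norm_triangle f g := by
    rw [norm_def, luxemburgNorm_congr Φ (val_add f g)]
    exact f.memOrlicz.luxemburgNorm_add_le f.val.aestronglyMeasurable g.memOrlicz
  norm_eq_zero_iff f := by
    constructor
    · intro h
      exact ext_ae ((f.memOrlicz.ae_eq_zero f.val.aestronglyMeasurable h).trans val_zero.symm)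
    · rintro rfl
      refine le_antisymm ?_ (luxemburgNorm_nonneg Φ μ _)
      have h := norm_le_mul (C := 1 / 2) (by norm_num) (f := (0 : OrliczSpace Φ μ))
        (g := (0 : OrliczSpace Φ μ)) (by filter_upwards [val_zero] with x hx; rw [hx]; simp)
      linarith

instance : NormedAddCommGroup (OrliczSpace Φ μ) := NormedAddCommGroup.ofCore core

instance : NormedSpace ℂ (OrliczSpace Φ μ) := NormedSpace.ofCore core

end OrliczSpace

end Orlicz

section Dynamics

variable {X : Type*} [TopologicalSpace X]

/-- `T` is recurrent: every nonempty open `U` meets `T⁻ⁿ U` for some positive integer `n`. -/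
def IsRecurrentMap (T : X → X) : Prop :=
  ∀ U : Set X, IsOpen U → U.Nonempty → ∃ n : ℕ, 1 ≤ n ∧ (U ∩ T^[n] ⁻¹' U).Nonempty

/-- `T` is topologically transitive: for all nonempty open `U`, `V` there is a positive integer `n`
such that `Tⁿ U` meets `V`. -/
def IsTransitiveMap (T : X → X) : Prop :=
  ∀ U V : Set X, IsOpen U → U.Nonempty → IsOpen V → V.Nonempty →
    ∃ n : ℕ, 1 ≤ n ∧ (T^[n] '' U ∩ V).Nonempty

end Dynamics

section Group

variable {G : Type*} [Group G]

/-- An element is aperiodic if the closed subgroup it generates is not compact. -/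
def IsAperiodic [TopologicalSpace G] (a : G) : Prop :=
  ¬ IsCompact (closure (Subgroup.zpowers a : Set G))

/-- A weight: a bounded continuous function `w : G → (0, ∞)`. -/
structure IsWeight [TopologicalSpace G] (w : G → ℝ) : Prop where
  continuous : Continuous w
  pos : ∀ x, 0 < w x
  bounded : BddAbove (range w)

/-- The convolution `f * δ_a` with the unit point mass at `a`, i.e. `(f * δ_a)(x) = f (x a⁻¹)`. -/
def convDirac {β : Type*} (f : G → β) (a : G) : G → β := fun x => f (x * a⁻¹)

/-- `φ_n = ∏_{j=1}^n w * δ_{a⁻¹}^j`, that is `φ_n x = w (x a) w (x a²) ⋯ w (x aⁿ)`. -/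
def weightProd (w : G → ℝ) (a : G) (n : ℕ) : G → ℝ :=
  fun x => ∏ j ∈ Finset.Icc 1 n, convDirac w (a⁻¹ ^ j) x

/-- `φ̃_n = (∏_{j=0}^{n-1} w * δ_a^j)⁻¹`, that is
`φ̃_n x = (w x · w (x a⁻¹) ⋯ w (x a^{-(n-1)}))⁻¹`. -/
def weightProdTilde (w : G → ℝ) (a : G) (n : ℕ) : G → ℝ :=
  fun x => (∏ j ∈ Finset.range n, convDirac w (a ^ j) x)⁻¹

/-- The supremum norm `‖f|_E‖_∞`, with values in `[0, ∞]`. -/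
def supNormOn {α : Type*} (f : α → ℝ) (E : Set α) : ℝ≥0∞ := ⨆ x ∈ E, ‖f x‖ₑ

/-- The function `w · (f * δ_a)`. -/
def weightedTranslationFun (a : G) (w : G → ℝ) (f : G → ℂ) : G → ℂ :=
  fun x => (w x : ℂ) * convDirac f a x

theorem IsWeight.exists_bound [TopologicalSpace G] {w : G → ℝ} (hw : IsWeight w) : ∃ C : ℝ, 0 < C ∧ ∀ x, w x ≤ C := by
  obtain ⟨C, hC⟩ := hw.bounded
  exact ⟨C, (hw.pos 1).trans_le (hC (mem_range_self 1)), fun x => hC (mem_range_self x)⟩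

theorem norm_weightedTranslationFun_le [TopologicalSpace G] {w : G → ℝ} (hw : IsWeight w) {C : ℝ}
    (hC : ∀ x, w x ≤ C) (a : G) (f : G → ℂ) (x : G) :
    ‖weightedTranslationFun a w f x‖ ≤ C * ‖convDirac f a x‖ := by
  rw [weightedTranslationFun, norm_mul, Complex.norm_real, Real.norm_of_nonneg (hw.pos x).le]
  gcongr
  exact hC x

variable [TopologicalSpace G] [IsTopologicalGroup G] [MeasurableSpace G] [BorelSpace G]

section

variable {Φ : YoungFunction} {μ : Measure G} [μ.IsMulRightInvariant]

theorem weightedTranslationFun_congr (a : G) (w : G → ℝ) {f g : G → ℂ} (h : f =ᵐ[μ] g) :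
    weightedTranslationFun a w f =ᵐ[μ] weightedTranslationFun a w g := by
  filter_upwards [(measurePreserving_mul_right μ a⁻¹).quasiMeasurePreserving.ae h] with x hx
  simp only [weightedTranslationFun, convDirac, hx]

theorem convDirac_aestronglyMeasurable (a : G) {f : G → ℂ} (hf : AEStronglyMeasurable f μ) :
    AEStronglyMeasurable (convDirac f a) μ :=
  hf.comp_measurePreserving (measurePreserving_mul_right μ a⁻¹)

theorem orliczModular_convDirac (a : G) {f : G → ℝ} (hf : AEMeasurable f μ) :
    orliczModular Φ μ (convDirac f a) = orliczModular Φ μ f := by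
  have hmp := measurePreserving_mul_right μ a⁻¹
  have hm : AEMeasurable (fun x => ENNReal.ofReal (Φ |f x|)) μ :=
    (Φ.continuous'.measurable.comp_aemeasurable
      (continuous_abs.measurable.comp_aemeasurable hf)).ennreal_ofReal
  unfold orliczModular
  conv_rhs => rw [← hmp.map_eq]
  rw [lintegral_map' (by rwa [hmp.map_eq]) hmp.measurable.aemeasurable]
  rfl

theorem memOrlicz_convDirac (a : G) {f : G → ℂ} (hfm : AEStronglyMeasurable f μ)
    (hf : MemOrlicz Φ μ f) : MemOrlicz Φ μ (convDirac f a) := by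
  obtain ⟨c, hc, h⟩ := hf
  refine ⟨c, hc, ?_⟩
  rwa [← orliczModular_convDirac a (hfm.norm.aemeasurable.const_mul c)] at h

theorem luxemburgNorm_convDirac (a : G) {f : G → ℂ} (hfm : AEStronglyMeasurable f μ) :
    luxemburgNorm Φ μ (convDirac f a) = luxemburgNorm Φ μ f := by
  unfold luxemburgNorm
  congr 1
  ext k
  simp only [mem_ofPred_eq]
  rw [← orliczModular_convDirac a (hfm.norm.aemeasurable.div_const k)]
  rfl

theorem weightedTranslationFun_aestronglyMeasurable (a : G) {w : G → ℝ} (hw : IsWeight w)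
    {f : G → ℂ} (hf : AEStronglyMeasurable f μ) :
    AEStronglyMeasurable (weightedTranslationFun a w f) μ :=
  (Complex.measurable_ofReal.comp hw.continuous.measurable).aestronglyMeasurable.mul
    (convDirac_aestronglyMeasurable a hf)

theorem memOrlicz_weightedTranslationFun (a : G) {w : G → ℝ} (hw : IsWeight w)
    {f : G → ℂ} (hfm : AEStronglyMeasurable f μ) (hf : MemOrlicz Φ μ f) :
    MemOrlicz Φ μ (weightedTranslationFun a w f) := by
  obtain ⟨C, hC0, hC⟩ := hw.exists_bound
  exact (memOrlicz_convDirac a hfm hf).of_le hC0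
    (ae_of_all _ (norm_weightedTranslationFun_le hw hC a f))

end

/-- The weighted translation `T_{a,w} f = w · (f * δ_a)` as a bounded operator on `L^Φ(G)`. -/
def weightedTranslation (Φ : YoungFunction) (μ : Measure G) [μ.IsMulRightInvariant] (a : G)
    (w : G → ℝ) (hw : IsWeight w) : OrliczSpace Φ μ →L[ℂ] OrliczSpace Φ μ :=
  LinearMap.mkContinuousOfExistsBound
    { toFun := fun f => OrliczSpace.mk (weightedTranslationFun a w f.val)
        (weightedTranslationFun_aestronglyMeasurable a hw f.val.aestronglyMeasurable)
        (memOrlicz_weightedTranslationFun a hw f.val.aestronglyMeasurable f.memOrlicz)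
      map_add' := fun f g => OrliczSpace.ext_ae <| by
        filter_upwards [OrliczSpace.val_mk _ _ _,
          weightedTranslationFun_congr a w (OrliczSpace.val_add f g), OrliczSpace.val_add _ _,
          OrliczSpace.val_mk (Φ := Φ) (weightedTranslationFun a w f.val)
            (weightedTranslationFun_aestronglyMeasurable a hw f.val.aestronglyMeasurable)
            (memOrlicz_weightedTranslationFun a hw f.val.aestronglyMeasurable f.memOrlicz),
          OrliczSpace.val_mk (Φ := Φ) (weightedTranslationFun a w g.val)
            (weightedTranslationFun_aestronglyMeasurable a hw g.val.aestronglyMeasurable)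
            (memOrlicz_weightedTranslationFun a hw g.val.aestronglyMeasurable g.memOrlicz)]
          with x h1 h2 h3 h4 h5
        rw [h1, h2, h3, Pi.add_apply, h4, h5]
        simp only [weightedTranslationFun, convDirac, Pi.add_apply, mul_add]
      map_smul' := fun c f => OrliczSpace.ext_ae <| by
        filter_upwards [OrliczSpace.val_mk _ _ _,
          weightedTranslationFun_congr a w (OrliczSpace.val_smul c f), OrliczSpace.val_smul c _,
          OrliczSpace.val_mk (Φ := Φ) (weightedTranslationFun a w f.val)
            (weightedTranslationFun_aestronglyMeasurable a hw f.val.aestronglyMeasurable)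
            (memOrlicz_weightedTranslationFun a hw f.val.aestronglyMeasurable f.memOrlicz)]
          with x h1 h2 h3 h4
        rw [h1, h2, RingHom.id_apply, h3, Pi.smul_apply, h4]
        simp only [weightedTranslationFun, convDirac, Pi.smul_apply, smul_eq_mul]
        ring }
    (by
      obtain ⟨C, hC0, hC⟩ := hw.exists_bound
      refine ⟨C, fun f => ?_⟩
      have hfm := f.val.aestronglyMeasurable
      rw [OrliczSpace.norm_def, OrliczSpace.norm_def]
      refine (luxemburgNorm_congr Φ (OrliczSpace.val_mk _
        (weightedTranslationFun_aestronglyMeasurable a hw hfm)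
        (memOrlicz_weightedTranslationFun a hw hfm f.memOrlicz))).trans_le ?_
      rw [← luxemburgNorm_convDirac a hfm]
      exact (memOrlicz_convDirac a hfm f.memOrlicz).luxemburgNorm_le_mul hC0
        (ae_of_all _ (norm_weightedTranslationFun_le hw hC a f.val)))

end Group

end

noncomputable section

/-! Recurrence implies (ii), (ii) implies transitivity, and transitivity trivially implies
recurrence, so one cycle gives both equivalences. Everything rests on two readings of the iterate:
`(T^n f)(x) = φ̃_n(x)⁻¹ f(x a⁻ⁿ)` and `(T^n f)(x aⁿ) = φ_n(x) f(x)`, which agree because `φ̃_n(x aⁿ)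
φ_n(x) = 1` (`weightProdTilde_mul_pow`).

From recurrence to (ii): aperiodicity makes `K aⁿ` disjoint from `K` for all large `n`
(`IsAperiodic.exists_forall_mul_pow_notMem`), and return times may be taken large. Let `f` and `T^n
f` both be close to the indicator of `K`. By Chebyshev, for `x` in `K` off a small set, `f(x)` and
`(T^n f)(x)` are near 1, whereas `f(x a⁻ⁿ)` and `(T^n f)(x aⁿ)` are near 0. The two formulas then
force `φ_n(x)` and `φ̃_n(x)` to be small.

From (ii) to transitivity: doubling allows `f` and `g` to be approximated by `p` and `q` vanishing
off `E_k`. There `φ_n` small makes `T^n p` small, and `φ̃_n` small gives `q = T^n s` with `s` small.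
Hence `p + s` is near `f`, and its image `T^n p + q` is near `g`. -/

theorem IsAperiodic.noncompactSpace {G : Type*} [Group G] [TopologicalSpace G] {a : G}
    (ha : IsAperiodic a) : NoncompactSpace G := by
  rw [← not_compactSpace_iff]
  exact fun _ => ha isClosed_closure.isCompact

/-! ### Powers of an aperiodic element leave every compact set. -/

section Aperiodic

open scoped Pointwise

variable {G : Type*} [Group G] [TopologicalSpace G] [IsTopologicalGroup G] {a : G}

/-- Two powers `a ^ m` and `a ^ n` near a common cluster point, with `n ≥ m + N`, have quotient `a ^
(n - m)` near 1. -/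
theorem frequently_pow_mem_nhds_one {C : Set G} (hC : IsCompact C)
    (h : ∃ᶠ n : ℕ in atTop, a ^ n ∈ C) {V : Set G} (hV : V ∈ 𝓝 (1 : G)) (N : ℕ) :
    ∃ n ≥ N, a ^ n ∈ V := by
  obtain ⟨g, -, hg⟩ := hC.exists_mapClusterPt_of_frequently h
  have hW : {p : G × G | p.1⁻¹ * p.2 ∈ V} ∈ 𝓝 (g, g) :=
    (by fun_prop : Continuous fun p : G × G => p.1⁻¹ * p.2).continuousAt.preimage_mem_nhds
      (by simpa using hV)
  obtain ⟨A, hA, B, hB, hAB⟩ := mem_nhds_prod_iff.1 hW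
  have hf := hg.frequently (p := fun x => x ∈ A ∩ B) (inter_mem hA hB)
  obtain ⟨m, hm⟩ := hf.exists
  obtain ⟨n, hn, hnm⟩ := frequently_atTop.1 hf (m + N)
  refine ⟨n - m, by omega, ?_⟩
  have := hAB (mk_mem_prod hm.1 hnm.2)
  simp only [mem_ofPred_eq] at this
  rwa [← zpow_natCast, Nat.cast_sub (by omega), zpow_sub, zpow_natCast, zpow_natCast,
    ((Commute.refl a).pow_pow n m).inv_right.eq]

/-- If infinitely many powers of `a` lie in a compact set, the closed subgroup generated by `a`
is compact. -/
theorem isCompact_closure_zpowers_of_frequently [LocallyCompactSpace G] [T2Space G] {C : Set G}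
    (hC : IsCompact C) (h : ∃ᶠ n : ℕ in atTop, a ^ n ∈ C) :
    IsCompact (closure (Subgroup.zpowers a : Set G)) := by
  set H := (Subgroup.zpowers a).topologicalClosure with hH
  have hHc : IsClosed (H : Set G) := (Subgroup.zpowers a).isClosed_topologicalClosure
  have haH : ∀ n : ℕ, a ^ n ∈ H := fun n =>
    (Subgroup.zpowers a).le_topologicalClosure (Subgroup.npow_mem_zpowers a n)
  have hcomm : ∀ x ∈ H, Commute x a := by
    intro x hx
    have hcl : IsClosed {x : G | x * a = a * x} := isClosed_eq (by fun_prop) (by fun_prop)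
    refine closure_minimal ?_ hcl hx
    rintro _ ⟨z, rfl⟩
    exact ((Commute.refl a).zpow_left z).eq
  -- Positive powers alone are dense in `H`: a nearby `a ^ z` is corrected by a factor `a ^ m` near
  -- 1 with `m > |z|`.
  have hpos : ∀ x ∈ H, ∀ V ∈ 𝓝 (1 : G), ∃ n : ℕ, 1 ≤ n ∧ x⁻¹ * a ^ n ∈ V := by
    intro x hx V hV
    obtain ⟨W, hWo, h1W, hWV⟩ := exists_open_nhds_one_mul_subset hV
    have hx' : {y : G | x⁻¹ * y ∈ W} ∈ 𝓝 x :=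
      (by fun_prop : Continuous fun y : G => x⁻¹ * y).continuousAt.preimage_mem_nhds
        (by simpa using hWo.mem_nhds h1W)
    obtain ⟨_, hy, z, rfl⟩ := mem_closure_iff_nhds.1 hx _ hx'
    obtain ⟨m, hm, hmW⟩ :=
      frequently_pow_mem_nhds_one hC h (hWo.mem_nhds h1W) (z.natAbs + 1)
    refine ⟨(z + m).toNat, by omega, hWV ?_⟩
    have e : x⁻¹ * a ^ (z + m).toNat = (x⁻¹ * a ^ z) * a ^ m := by
      rw [← zpow_natCast, Int.toNat_of_nonneg (by omega), zpow_add, zpow_natCast, mul_assoc]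
    rw [e]
    exact mul_mem_mul hy hmW
  obtain ⟨K, hK, h1K⟩ := exists_compact_mem_nhds (1 : G)
  -- For `y` in `K ∩ H` some positive step `i` brings `a⁻ⁱ y` into the interior of `K`; by
  -- compactness finitely many steps `i ∈ t` serve all such `y`.
  have hcov : (K ∩ H : Set G) ⊆ ⋃ i : ℕ, {x | 1 ≤ i ∧ (x⁻¹ * a ^ i)⁻¹ ∈ interior K} := by
    intro x hx
    obtain ⟨i, hi, hiK⟩ := hpos x hx.2 (interior K)⁻¹
      (inv_mem_nhds_one G (interior_mem_nhds.2 h1K))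
    exact mem_iUnion.2 ⟨i, hi, hiK⟩
  obtain ⟨t, ht⟩ := (hK.inter_right hHc).elim_finite_subcover _ (fun i => by
    have : {x : G | 1 ≤ i ∧ (x⁻¹ * a ^ i)⁻¹ ∈ interior K} =
        {x | 1 ≤ i} ∩ {x | (x⁻¹ * a ^ i)⁻¹ ∈ interior K} := rfl
    rw [this]
    exact isOpen_const.inter (isOpen_interior.preimage (by fun_prop))) hcov
  -- Let `n ≥ 1` be least with `x⁻¹ a ^ n ∈ K`. Some `i ∈ t` sends this point back to `x⁻¹ a ^ (n -
  -- i)` in `K`, so minimality gives `n ≤ i ≤ max t`. Thus `H` is covered by finitely many compact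
  -- sets `a ^ n K⁻¹`.
  have hfin : (H : Set G) ⊆ ⋃ n ∈ Finset.range (t.sup id + 1), (fun y => a ^ n * y⁻¹) '' K := by
    intro x hx
    have hex := hpos x hx K h1K
    classical
    set n := Nat.find hex with hn
    obtain ⟨hn1, hnK⟩ := Nat.find_spec hex
    rw [← hn] at hn1 hnK
    obtain ⟨i, hit, hi1, hi⟩ := mem_iUnion₂.1
      (ht ⟨hnK, H.mul_mem (H.inv_mem hx) (haH n)⟩)
    have hni : n ≤ i := by
      by_contra! hlt
      refine Nat.find_min hex (m := n - i) (by omega) ⟨by omega, interior_subset ?_⟩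
      convert hi using 1
      rw [← zpow_natCast, Nat.cast_sub hlt.le, zpow_sub, zpow_natCast, zpow_natCast]
      have := (hcomm x hx).inv_left.pow_right i
      simp only [mul_inv_rev, inv_inv]
      rw [((Commute.refl a).pow_pow n i).inv_right.eq, ← mul_assoc, this.inv_right.eq, mul_assoc]
    have : i ≤ t.sup id := Finset.le_sup (f := id) hit
    refine mem_iUnion₂.2 ⟨n, Finset.mem_range.2 (by omega), _, hnK, ?_⟩
    simp
  exact ((Finset.range _).isCompact_biUnion fun n _ =>
    hK.image (by fun_prop)).of_isClosed_subset hHc hfin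

/-- If `x` and `x a ^ n` both lie in `K`, then `a ^ n` lies in the compact set `K⁻¹ K`. -/
theorem IsAperiodic.exists_forall_mul_pow_notMem [LocallyCompactSpace G] [T2Space G]
    (ha : IsAperiodic a) {K : Set G} (hK : IsCompact K) :
    ∃ N : ℕ, ∀ n ≥ N, ∀ x ∈ K, x * a ^ n ∉ K := by
  by_contra! hcon
  refine ha (isCompact_closure_zpowers_of_frequently (hK.inv.mul hK) (frequently_atTop.2 fun N => ?_))
  obtain ⟨n, hn, x, hx, hxK⟩ := hcon N
  exact ⟨n, hn, by simpa using mul_mem_mul (inv_mem_inv.2 hx) hxK⟩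

end Aperiodic

/-! ### Return times of recurrent maps. -/

section Recurrent

variable {X : Type*} [TopologicalSpace X] {T : X → X}

theorem IsRecurrentMap.exists_ge (hT : IsRecurrentMap T) (hc : Continuous T) (N : ℕ) {U : Set X}
    (hU : IsOpen U) (hne : U.Nonempty) : ∃ n ≥ N, (U ∩ T^[n] ⁻¹' U).Nonempty := by
  induction N with
  | zero =>
    obtain ⟨n, -, h⟩ := hT U hU hne
    exact ⟨n, n.zero_le, h⟩
  | succ N ih =>
    obtain ⟨n, hn, h⟩ := ih
    -- Recurrence of the open set `U ∩ T⁻ⁿ U` lengthens the return time `n` by some `m ≥ 1`.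
    obtain ⟨m, hm, x, hx, hx'⟩ := hT _ (hU.inter (hU.preimage (hc.iterate n))) h
    refine ⟨n + m, by omega, x, hx.1, ?_⟩
    rw [mem_preimage, Function.iterate_add_apply]
    exact hx'.2

theorem IsTransitiveMap.isRecurrentMap (hT : IsTransitiveMap T) : IsRecurrentMap T := by
  intro U hU hne
  obtain ⟨n, hn, _, ⟨x, hx, rfl⟩, hxU⟩ := hT U U hU hne hU hne
  exact ⟨n, hn, x, hx, hxU⟩

end Recurrent

/-! ### Estimates for the modular and the Luxemburg norm. -/

section OrliczEstimates

variable {α : Type*} [MeasurableSpace α] {Φ : YoungFunction} {μ : Measure α}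

theorem luxemburgNorm_le_of_bound {f : α → ℂ} {A : Set α} {C ε : ℝ} (hε : 0 < ε)
    (hf : ∀ x, ‖f x‖ ≤ C) (hfA : ∀ x ∉ A, f x = 0)
    (h : ENNReal.ofReal (Φ (C / ε)) * μ A ≤ 1) : luxemburgNorm Φ μ f ≤ ε := by
  refine luxemburgNorm_le Φ hε (le_trans ?_ h)
  refine le_trans (lintegral_mono fun x => ?_) (lintegral_indicator_const_le A _)
  by_cases hx : x ∈ A
  · rw [indicator_of_mem hx, abs_of_nonneg (by positivity)]
    exact ENNReal.ofReal_le_ofReal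
      (Φ.mono (by positivity) (div_le_div_of_nonneg_right (hf x) hε.le))
  · simp [hfA x hx, Φ.map_zero']

theorem memOrlicz_of_bound {f : α → ℂ} {A : Set α} {C : ℝ}
    (hf : ∀ x, ‖f x‖ ≤ C) (hfA : ∀ x ∉ A, f x = 0) (hA : μ A < ∞) : MemOrlicz Φ μ f := by
  refine ⟨1, one_pos, ?_⟩
  refine lt_of_le_of_lt (lintegral_mono fun x => ?_)
    ((lintegral_indicator_const_le A (ENNReal.ofReal (Φ C))).trans_lt
      (ENNReal.mul_lt_top ENNReal.ofReal_lt_top hA))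
  by_cases hx : x ∈ A
  · rw [indicator_of_mem hx, abs_of_nonneg (by positivity)]
    exact ENNReal.ofReal_le_ofReal (Φ.mono (by positivity) (by simpa using hf x))
  · simp [hfA x hx, Φ.map_zero']

/-- A Chebyshev inequality for the Luxemburg norm. -/
theorem MemOrlicz.mul_meas_ge_le {f : α → ℂ} (hfm : AEStronglyMeasurable f μ)
    (hf : MemOrlicz Φ μ f) {δ η : ℝ} (hδ : luxemburgNorm Φ μ f < δ) (hη : 0 ≤ η) :
    ENNReal.ofReal (Φ (η / δ)) * μ {x | η ≤ ‖f x‖} ≤ 1 := by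
  have hδ0 : 0 < δ := (luxemburgNorm_nonneg Φ μ f).trans_lt hδ
  refine le_trans ?_ (hf.modular_le_of_lt hδ)
  have hm : AEMeasurable (fun x => ENNReal.ofReal (Φ |‖f x‖ / δ|)) μ :=
    (Φ.continuous'.measurable.comp_aemeasurable
      (continuous_abs.measurable.comp_aemeasurable
        (hfm.norm.aemeasurable.div_const δ))).ennreal_ofReal
  refine le_trans ?_ (mul_meas_ge_le_lintegral₀ hm (ENNReal.ofReal (Φ (η / δ))))
  gcongr with x
  intro hx
  rw [abs_of_nonneg (by positivity)]
  exact ENNReal.ofReal_le_ofReal (Φ.mono (by positivity) (by gcongr))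

/-- Functions of small Luxemburg norm are small outside a set of small measure. -/
theorem exists_luxemburgNorm_lt_imp_meas_le (Φ : YoungFunction) (μ : Measure α) {η r : ℝ}
    (hη : 0 < η) (hr : 0 < r) :
    ∃ δ > 0, ∀ f : α → ℂ, AEStronglyMeasurable f μ → MemOrlicz Φ μ f →
      luxemburgNorm Φ μ f < δ → μ {x | η ≤ ‖f x‖} ≤ ENNReal.ofReal r := by
  -- With `Φ t ≥ 1 / r` and `δ = η / t`, the Chebyshev factor `Φ (η / δ)` is `Φ t`.
  obtain ⟨t, ht, ht0⟩ :=
    ((Φ.tendsto'.eventually_ge_atTop r⁻¹).and (eventually_gt_atTop 0)).exists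
  refine ⟨η / t, by positivity, fun f hfm hf hlt => ?_⟩
  have h := hf.mul_meas_ge_le hfm hlt hη.le
  rw [div_div_cancel₀ hη.ne'] at h
  have h2 : ENNReal.ofReal r⁻¹ * μ {x | η ≤ ‖f x‖} ≤ 1 :=
    le_trans (by gcongr) h
  rw [ENNReal.ofReal_inv_of_pos hr] at h2
  calc μ {x | η ≤ ‖f x‖}
      = ENNReal.ofReal r * ((ENNReal.ofReal r)⁻¹ * μ {x | η ≤ ‖f x‖}) := by
        rw [← mul_assoc, ENNReal.mul_inv_cancel (by simpa using hr) ENNReal.ofReal_ne_top, one_mul]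
    _ ≤ ENNReal.ofReal r * 1 := by gcongr
    _ = _ := mul_one _

/-- Doubling `m` times, where `2 ^ m * d ≥ |c|`, costs only the factor `M ^ m`. This is where the
doubling condition does its work: it makes dominated convergence available at every scale. -/
theorem MemOrlicz.modular_mul_lt_top {M : ℝ} (hM : 0 < M)
    (hΦ : ∀ t > 0, Φ (2 * t) ≤ M * Φ t) {f : α → ℂ} (hf : MemOrlicz Φ μ f) (c : ℝ) :
    orliczModular Φ μ (fun x => c * ‖f x‖) < ∞ := by
  obtain ⟨d, hd, hfd⟩ := hf
  have hΦ' : ∀ t : ℝ, 0 ≤ t → Φ (2 * t) ≤ M * Φ t := by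
    intro t ht
    rcases ht.eq_or_lt with rfl | h
    · simp [Φ.map_zero']
    · exact hΦ t h
  have hpow : ∀ m : ℕ, ∀ t : ℝ, 0 ≤ t → Φ (2 ^ m * t) ≤ M ^ m * Φ t := by
    intro m
    induction m with
    | zero => simp
    | succ m ih =>
      intro t ht
      calc Φ (2 ^ (m + 1) * t) = Φ (2 * (2 ^ m * t)) := by ring_nf
        _ ≤ M * Φ (2 ^ m * t) := hΦ' _ (by positivity)
        _ ≤ M * (M ^ m * Φ t) := by gcongr; exact ih t ht
        _ = _ := by ring
  obtain ⟨m, hm⟩ := pow_unbounded_of_one_lt (|c| / d) (one_lt_two : (1 : ℝ) < 2)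
  have hcm : |c| ≤ 2 ^ m * d := ((div_lt_iff₀ hd).1 hm).le
  refine lt_of_le_of_lt (b := ∫⁻ x, ENNReal.ofReal (M ^ m) * ENNReal.ofReal (Φ |d * ‖f x‖|) ∂μ)
    (lintegral_mono fun x => ?_) ?_
  · rw [← ENNReal.ofReal_mul (by positivity)]
    refine ENNReal.ofReal_le_ofReal ((Φ.mono (abs_nonneg _) ?_).trans (hpow m _ (abs_nonneg _)))
    rw [abs_mul, abs_mul, abs_of_nonneg hd.le, ← mul_assoc]
    gcongr
  · rw [lintegral_const_mul' _ _ ENNReal.ofReal_ne_top]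
    exact ENNReal.mul_lt_top ENNReal.ofReal_lt_top hfd

/-- Dominated convergence in the Luxemburg norm, for dominating functions all of whose dilates
have finite modular. -/
theorem tendsto_luxemburgNorm_zero {f : α → ℂ} {g : ℕ → α → ℂ}
    (hf : ∀ c : ℝ, orliczModular Φ μ (fun x => c * ‖f x‖) < ∞)
    (hg : ∀ n, AEStronglyMeasurable (g n) μ) (hle : ∀ n x, ‖g n x‖ ≤ ‖f x‖)
    (hlim : ∀ x, Tendsto (fun n => g n x) atTop (𝓝 0)) {ε : ℝ} (hε : 0 < ε) :
    ∀ᶠ n in atTop, luxemburgNorm Φ μ (g n) ≤ ε := by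
  have h : Tendsto (fun n => orliczModular Φ μ fun x => ‖g n x‖ / ε) atTop (𝓝 0) := by
    have e : (0 : ℝ≥0∞) = ∫⁻ _, 0 ∂μ := by simp
    rw [e]
    refine tendsto_lintegral_of_dominated_convergence'
      (fun x => ENNReal.ofReal (Φ |ε⁻¹ * ‖f x‖|)) (fun n => ?_) (fun n => ?_) (hf ε⁻¹).ne ?_
    · exact (Φ.continuous'.measurable.comp_aemeasurable
        (continuous_abs.measurable.comp_aemeasurable
          ((hg n).norm.aemeasurable.div_const ε))).ennreal_ofReal
    · refine ae_of_all _ fun x => ENNReal.ofReal_le_ofReal (Φ.mono (abs_nonneg _) ?_)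
      rw [abs_of_nonneg (by positivity), abs_of_nonneg (by positivity)]
      exact (div_le_div_of_nonneg_right (hle n x) hε.le).trans_eq (div_eq_inv_mul _ _)
    · refine ae_of_all _ fun x => ?_
      have hc : Continuous fun z : ℂ => ENNReal.ofReal (Φ |‖z‖ / ε|) :=
        ENNReal.continuous_ofReal.comp (Φ.continuous'.comp (by fun_prop))
      simpa [Φ.map_zero', Function.comp_def] using (hc.tendsto 0).comp (hlim x)
  filter_upwards [h.eventually_le_const one_pos] with n hn
  exact luxemburgNorm_le Φ hε hn

end OrliczEstimates

/-! ### Density of bounded functions with compact support. -/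

namespace OrliczSpace

theorem norm_mk {α : Type*} [MeasurableSpace α] {Φ : YoungFunction} {μ : Measure α} {f : α → ℂ}
    (hfm : AEStronglyMeasurable f μ) (hf : MemOrlicz Φ μ f) :
    ‖mk f hfm hf‖ = luxemburgNorm Φ μ f :=
  luxemburgNorm_congr Φ (val_mk f hfm hf)

theorem val_sub {α : Type*} [MeasurableSpace α] {Φ : YoungFunction} {μ : Measure α}
    (f g : OrliczSpace Φ μ) : (f - g).val =ᵐ[μ] f.val - g.val :=
  AEEqFun.coeFn_sub f.val g.val

/-- Bounded measurable functions vanishing outside a compact set are dense in `L^Φ` when `Φ` is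
doubling. -/
theorem exists_norm_sub_mk_le {G : Type*} [TopologicalSpace G] [T2Space G]
    [SigmaCompactSpace G] [MeasurableSpace G] [BorelSpace G] {Φ : YoungFunction} {μ : Measure G}
    {M : ℝ} (hM : 0 < M) (hΦ : ∀ t > 0, Φ (2 * t) ≤ M * Φ t)
    (f : OrliczSpace Φ μ) {ε : ℝ} (hε : 0 < ε) :
    ∃ (g : G → ℂ) (hgm : Measurable g) (hg : MemOrlicz Φ μ g) (K : Set G) (C : ℝ),
      IsCompact K ∧ (∀ x ∉ K, g x = 0) ∧ (∀ x, ‖g x‖ ≤ C) ∧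
      ‖f - mk g hgm.aestronglyMeasurable hg‖ ≤ ε := by
  have hfm : Measurable f.val := f.val.stronglyMeasurable.measurable
  -- Truncation in space and in size at once. Every point eventually lies in `S n`, so the tails of
  -- `f` off `S n` tend to 0 pointwise, dominated by `f`.
  set S : ℕ → Set G := fun n => compactCovering G n ∩ {x | ‖f.val x‖ ≤ n} with hS
  have hSm : ∀ n, MeasurableSet (S n) := fun n =>
    (isCompact_compactCovering G n).measurableSet.inter
      (measurableSet_le hfm.norm measurable_const)
  have hSx : ∀ x, ∀ᶠ n in atTop, x ∈ S n := by
    intro x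
    obtain ⟨m, hm⟩ := mem_iUnion.1 ((iUnion_compactCovering G).symm ▸ mem_univ x)
    obtain ⟨k, hk⟩ := exists_nat_ge ‖f.val x‖
    filter_upwards [eventually_ge_atTop m, eventually_ge_atTop k] with n hn hn'
    exact ⟨compactCovering_subset G hn hm, hk.trans (by exact_mod_cast hn')⟩
  have hev := tendsto_luxemburgNorm_zero (μ := μ) (Φ := Φ) (f := f.val)
    (g := fun n => (S n)ᶜ.indicator f.val) (f.memOrlicz.modular_mul_lt_top hM hΦ)
    (fun n => (hfm.indicator (hSm n).compl).aestronglyMeasurable)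
    (fun n x => norm_indicator_le_norm_self _ _)
    (fun x => tendsto_const_nhds.congr' <| by
      filter_upwards [hSx x] with n hn
      rw [indicator_of_notMem (by simpa using hn)]) hε
  obtain ⟨n, hn⟩ := hev.exists
  refine ⟨(S n).indicator f.val, hfm.indicator (hSm n), ?_, compactCovering G n, n,
    isCompact_compactCovering G n, ?_, ?_, ?_⟩
  · exact f.memOrlicz.of_le one_pos (ae_of_all _ fun x => by
      rw [one_mul]; exact norm_indicator_le_norm_self _ _)
  · exact fun x hx => indicator_of_notMem (fun h => hx h.1) _
  · intro x
    by_cases hx : x ∈ S n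
    · rw [indicator_of_mem hx]; exact hx.2
    · simp [indicator_of_notMem hx]
  · rw [norm_def]
    refine (luxemburgNorm_congr Φ ?_).trans_le hn
    filter_upwards [val_sub f _, val_mk ((S n).indicator f.val)
      (hfm.indicator (hSm n)).aestronglyMeasurable (f.memOrlicz.of_le one_pos
        (ae_of_all _ fun x => by rw [one_mul]; exact norm_indicator_le_norm_self _ _))] with x h1 h2
    rw [h1, Pi.sub_apply, h2, indicator_compl, Pi.sub_apply]

end OrliczSpace

/-! ### The weight products. -/

section Weights

variable {G : Type*} [Group G] {a : G} {w : G → ℝ}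

theorem weightProdTilde_mul_pow (w : G → ℝ) (a : G) (n : ℕ) (x : G) :
    weightProdTilde w a n (x * a ^ n) = (weightProd w a n x)⁻¹ := by
  unfold weightProdTilde weightProd
  -- Seen from `x a ^ n`, the backward orbit runs through the points `x a, …, x a ^ n` in reverse
  -- order.
  rw [← Finset.prod_range_reflect, ← Finset.Ico_add_one_right_eq_Icc, Finset.prod_Ico_eq_prod_range]
  congr 1
  refine Finset.prod_congr (by simp) fun j hj => ?_
  have hj' := Finset.mem_range.1 hj
  have e : a ^ n = a ^ (1 + j) * a ^ (n - 1 - j) := by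
    rw [← pow_add]; congr 1; omega
  simp [convDirac, e, mul_assoc]

variable [TopologicalSpace G]

theorem IsWeight.weightProd_pos (hw : IsWeight w) (a : G) (n : ℕ) (x : G) :
    0 < weightProd w a n x :=
  Finset.prod_pos fun _ _ => hw.pos _

theorem IsWeight.weightProdTilde_pos (hw : IsWeight w) (a : G) (n : ℕ) (x : G) :
    0 < weightProdTilde w a n x :=
  inv_pos.2 (Finset.prod_pos fun _ _ => hw.pos _)

theorem IsWeight.continuous_weightProdTilde [IsTopologicalGroup G] (hw : IsWeight w) (a : G)
    (n : ℕ) : Continuous (weightProdTilde w a n) :=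
  (continuous_finsetProd _ fun j _ =>
    hw.continuous.comp (by fun_prop : Continuous fun x : G => x * (a ^ j)⁻¹)).inv₀
      fun _ => (Finset.prod_pos fun _ _ => hw.pos _).ne'

end Weights

theorem le_of_supNormOn_le {α : Type*} {f : α → ℝ} {E : Set α} {c : ℝ} (hc : 0 ≤ c)
    (h : supNormOn f E ≤ ENNReal.ofReal c) {x : α} (hx : x ∈ E) : f x ≤ c := by
  have h1 : ‖f x‖ₑ ≤ ENNReal.ofReal c := (le_iSup₂ (f := fun x _ => ‖f x‖ₑ) x hx).trans h
  rw [← ofReal_norm, ENNReal.ofReal_le_ofReal_iff hc] at h1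
  exact (Real.le_norm_self _).trans h1

theorem supNormOn_le {α : Type*} {f : α → ℝ} {E : Set α} {c : ℝ}
    (h : ∀ x ∈ E, 0 ≤ f x ∧ f x ≤ c) : supNormOn f E ≤ ENNReal.ofReal c :=
  iSup₂_le fun x hx => by
    rw [← ofReal_norm, Real.norm_of_nonneg (h x hx).1]
    exact ENNReal.ofReal_le_ofReal (h x hx).2

/-! ### Iterates of the weighted translation and their partial inverses. -/

section Operator

variable {G : Type*} [Group G] [TopologicalSpace G] [IsTopologicalGroup G] [MeasurableSpace G]
  [BorelSpace G] {Φ : YoungFunction} {μ : Measure G} [μ.IsMulRightInvariant] {a : G} {w : G → ℝ}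

theorem weightedTranslation_val (hw : IsWeight w) (f : OrliczSpace Φ μ) :
    (weightedTranslation Φ μ a w hw f).val =ᵐ[μ] weightedTranslationFun a w f.val :=
  OrliczSpace.val_mk _
    (weightedTranslationFun_aestronglyMeasurable a hw f.val.aestronglyMeasurable)
    (memOrlicz_weightedTranslationFun a hw f.val.aestronglyMeasurable f.memOrlicz)

theorem weightedTranslation_iterate_val (hw : IsWeight w) (n : ℕ) (f : OrliczSpace Φ μ) :
    ((weightedTranslation Φ μ a w hw)^[n] f).val =ᵐ[μ]
      fun x => ((weightProdTilde w a n x)⁻¹ : ℝ) * f.val (x * (a ^ n)⁻¹) := by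
  induction n with
  | zero => simp [weightProdTilde]
  | succ n ih =>
    rw [Function.iterate_succ_apply']
    refine (weightedTranslation_val hw _).trans ((weightedTranslationFun_congr a w ih).trans ?_)
    refine ae_of_all _ fun x => ?_
    simp only [weightedTranslationFun, weightProdTilde, convDirac, inv_inv,
      Finset.prod_range_succ', pow_succ, mul_inv_rev, mul_assoc, Complex.ofReal_mul]
    simp only [pow_zero, inv_one, mul_one]
    rw [mul_left_comm]

/-- In this form `T^n f` is a pure translate of `φ_n f`. Translation preserves the Luxemburg norm,
so the size of `T^n f` is governed by `φ_n` on the support of `f`. -/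
theorem weightedTranslation_iterate_val' (hw : IsWeight w) (n : ℕ) (f : OrliczSpace Φ μ) :
    ((weightedTranslation Φ μ a w hw)^[n] f).val =ᵐ[μ]
      convDirac (fun x => (weightProd w a n x : ℂ) * f.val x) (a ^ n) := by
  filter_upwards [weightedTranslation_iterate_val hw n f] with x hx
  rw [hx, convDirac, ← inv_inv (weightProd w a n (x * (a ^ n)⁻¹)), ← weightProdTilde_mul_pow,
    inv_mul_cancel_right]

theorem norm_weightedTranslation_iterate_le (hw : IsWeight w) {n : ℕ} {f : OrliczSpace Φ μ}
    {E : Set G} {c : ℝ} (hc : 0 < c) (hf : ∀ᵐ x ∂μ, x ∉ E → f.val x = 0)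
    (hE : ∀ x ∈ E, weightProd w a n x ≤ c) :
    ‖(weightedTranslation Φ μ a w hw)^[n] f‖ ≤ c * ‖f‖ := by
  have hqmp := (measurePreserving_mul_right μ (a ^ n)).quasiMeasurePreserving
  -- Measurability of `φ_n f` is read off from `T^n f` translated back by `a ^ n`.
  have hm : AEStronglyMeasurable (fun x => (weightProd w a n x : ℂ) * f.val x) μ := by
    refine AEStronglyMeasurable.congr
      (convDirac_aestronglyMeasurable (a ^ n)⁻¹
        ((weightedTranslation Φ μ a w hw)^[n] f).val.aestronglyMeasurable) ?_
    filter_upwards [hqmp.ae (weightedTranslation_iterate_val' hw n f)] with x hx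
    simp only [convDirac, inv_inv] at hx ⊢
    rw [hx, mul_inv_cancel_right]
  rw [OrliczSpace.norm_def, luxemburgNorm_congr Φ (weightedTranslation_iterate_val' hw n f),
    luxemburgNorm_convDirac _ hm]
  refine f.memOrlicz.luxemburgNorm_le_mul hc ?_
  filter_upwards [hf] with x hx
  by_cases hxE : x ∈ E
  · rw [norm_mul, Complex.norm_real, Real.norm_of_nonneg (hw.weightProd_pos a n x).le]
    gcongr
    exact hE x hxE
  · simp [hx hxE]

/-- A preimage of `g` under the `n`-th iterate whose norm is controlled by `φ̃_n` on the support
of `g`. -/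
theorem exists_weightedTranslation_iterate_eq [SecondCountableTopology G] (hw : IsWeight w)
    {n : ℕ} {g : OrliczSpace Φ μ} {E : Set G} {c : ℝ} (hc : 0 < c) (hg : ∀ᵐ x ∂μ, x ∉ E → g.val x = 0)
    (hE : ∀ x ∈ E, weightProdTilde w a n x ≤ c) :
    ∃ h, (weightedTranslation Φ μ a w hw)^[n] h = g ∧ ‖h‖ ≤ c * ‖g‖ := by
  set u : G → ℂ := fun x => (weightProdTilde w a n x : ℂ) * g.val x with hu
  have hum : AEStronglyMeasurable u μ :=
    (Complex.continuous_ofReal.comp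
      (hw.continuous_weightProdTilde a n)).measurable.aestronglyMeasurable.mul
        g.val.aestronglyMeasurable
  have hle : ∀ᵐ x ∂μ, ‖u x‖ ≤ c * ‖g.val x‖ := by
    filter_upwards [hg] with x hx
    by_cases hxE : x ∈ E
    · rw [norm_mul, Complex.norm_real, Real.norm_of_nonneg (hw.weightProdTilde_pos a n x).le]
      gcongr
      exact hE x hxE
    · simp [hu, hx hxE]
  have huo : MemOrlicz Φ μ u := g.memOrlicz.of_le hc hle
  -- The preimage is `x ↦ u (x a ^ n)`: the iterate translates it back to `u` and divides by `φ̃_n`,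
  -- leaving `g`.
  refine ⟨.mk (convDirac u (a ^ n)⁻¹) (convDirac_aestronglyMeasurable _ hum)
    (memOrlicz_convDirac _ hum huo), OrliczSpace.ext_ae ?_, ?_⟩
  · have hqmp := (measurePreserving_mul_right μ (a ^ n)⁻¹).quasiMeasurePreserving
    filter_upwards [weightedTranslation_iterate_val hw n _, hqmp.ae (OrliczSpace.val_mk
      (convDirac u (a ^ n)⁻¹) (convDirac_aestronglyMeasurable _ hum)
        (memOrlicz_convDirac _ hum huo))] with x h1 h2
    rw [h1, h2]
    have := (hw.weightProdTilde_pos a n x).ne'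
    simp only [convDirac, hu, inv_inv, inv_mul_cancel_right, Complex.ofReal_inv]
    rw [inv_mul_cancel_left₀ (by exact_mod_cast this)]
  · rw [OrliczSpace.norm_mk, luxemburgNorm_convDirac _ hum]
    exact g.memOrlicz.luxemburgNorm_le_mul hc hle

end Operator

/-- Every element of `L^Φ` can be approximated by elements vanishing off `E`, as soon as `E` fills
enough of a suitable compact set. -/
theorem OrliczSpace.exists_approx_vanishing_off {G : Type*} [TopologicalSpace G] [T2Space G]
    [SigmaCompactSpace G] [MeasurableSpace G] [BorelSpace G] {Φ : YoungFunction} {μ : Measure G}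
    {M : ℝ} (hM : 0 < M) (hΦ : ∀ t > 0, Φ (2 * t) ≤ M * Φ t)
    (f : OrliczSpace Φ μ) {ε : ℝ} (hε : 0 < ε) :
    ∃ K : Set G, IsCompact K ∧ ∃ r : ℝ≥0∞, 0 < r ∧ ∀ E : Set G, MeasurableSet E →
      μ (K \ E) ≤ r → ∃ g : OrliczSpace Φ μ, (∀ᵐ x ∂μ, x ∉ E → g.val x = 0) ∧ ‖f - g‖ ≤ ε := by
  obtain ⟨g, hgm, hg, K, C, hK, hgK, hgC, hfg⟩ := f.exists_norm_sub_mk_le hM hΦ (half_pos hε)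
  -- Cutting `g` down to `E` removes a function bounded by `C` and living on `K \ E`. Its modular at
  -- scale `ε / 2` is at most `Φ (C / (ε / 2)) * μ (K \ E)`, which this radius keeps below 1. If the
  -- `Φ` value is 0, the radius is `∞`.
  refine ⟨K, hK, (ENNReal.ofReal (Φ (C / (ε / 2))))⁻¹,
    ENNReal.inv_pos.2 ENNReal.ofReal_ne_top, fun E hE hKE => ?_⟩
  have hm := (hgm.indicator hE).aestronglyMeasurable (μ := μ)
  have ho : MemOrlicz Φ μ (E.indicator g) := hg.of_le one_pos (ae_of_all _ fun x => by
    rw [one_mul]; exact norm_indicator_le_norm_self _ _)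
  refine ⟨mk (E.indicator g) hm ho, ?_, ?_⟩
  · filter_upwards [val_mk _ hm ho] with x hx hxE
    rw [hx, indicator_of_notMem hxE]
  · have h2 : ‖mk g hgm.aestronglyMeasurable hg - mk (E.indicator g) hm ho‖ ≤ ε / 2 := by
      rw [norm_def]
      refine (luxemburgNorm_congr Φ (g := Eᶜ.indicator g) ?_).trans_le ?_
      · filter_upwards [val_sub (mk g hgm.aestronglyMeasurable hg) (mk (E.indicator g) hm ho),
          val_mk _ hm ho, val_mk _ hgm.aestronglyMeasurable hg] with x h1 h2 h3
        rw [h1, Pi.sub_apply, h2, h3, indicator_compl, Pi.sub_apply]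
      · refine luxemburgNorm_le_of_bound (A := K \ E) (C := C) (half_pos hε)
          (fun x => (norm_indicator_le_norm_self _ _).trans (hgC x)) (fun x hx => ?_) ?_
        · by_cases hxE : x ∈ E
          · exact indicator_of_notMem (by simpa using hxE) _
          · rw [indicator_of_mem (by simpa using hxE)]
            exact hgK x fun h => hx ⟨h, hxE⟩
        · exact (mul_le_mul_right hKE _).trans (ENNReal.mul_inv_le_one _)
    calc _ ≤ _ := norm_sub_le_norm_sub_add_norm_sub _ (mk g hgm.aestronglyMeasurable hg) _
      _ ≤ ε / 2 + ε / 2 := add_le_add hfg h2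
      _ = ε := add_halves ε

/-! ### The implications between recurrence, the weight condition and transitivity. -/

section Main

variable {G : Type*} [Group G] [TopologicalSpace G] [IsTopologicalGroup G]
  [LocallyCompactSpace G] [T2Space G] [MeasurableSpace G]
  [BorelSpace G] {μ : Measure G} [μ.IsMulRightInvariant] {Φ : YoungFunction} {a : G} {w : G → ℝ}

theorem isTransitiveMap_weightedTranslation [SecondCountableTopology G]
    [IsFiniteMeasureOnCompacts μ] [μ.IsOpenPosMeasure]
    {M : ℝ} (hM : 0 < M) (hΦ : ∀ t > 0, Φ (2 * t) ≤ M * Φ t) (hw : IsWeight w)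
    (h : ∀ K : Set G, IsCompact K → 0 < μ K →
      ∃ (E : ℕ → Set G) (n : ℕ → ℕ), (∀ k, MeasurableSet (E k)) ∧ (∀ k, E k ⊆ K) ∧
        Tendsto (fun k => μ (E k)) atTop (𝓝 (μ K)) ∧ StrictMono n ∧
        Tendsto (fun k => supNormOn (weightProd w a (n k)) (E k)) atTop (𝓝 0) ∧
        Tendsto (fun k => supNormOn (weightProdTilde w a (n k)) (E k)) atTop (𝓝 0)) :
    IsTransitiveMap (weightedTranslation Φ μ a w hw) := by
  rintro U V hU ⟨f, hf⟩ hV ⟨g, hg⟩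
  obtain ⟨ε₁, hε₁, hεU⟩ := Metric.isOpen_iff.1 hU f hf
  obtain ⟨ε₂, hε₂, hεV⟩ := Metric.isOpen_iff.1 hV g hg
  obtain ⟨ε, hε, hεε⟩ : ∃ ε > 0, 2 * ε < min ε₁ ε₂ :=
    ⟨min ε₁ ε₂ / 3, by positivity, by have : 0 < min ε₁ ε₂ := lt_min hε₁ hε₂; linarith⟩
  obtain ⟨Kf, hKf, rf, hrf, hf'⟩ := f.exists_approx_vanishing_off hM hΦ hε
  obtain ⟨Kg, hKg, rg, hrg, hg'⟩ := g.exists_approx_vanishing_off hM hΦ hε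
  -- A compact neighbourhood of 1 is adjoined to guarantee `μ K > 0`, since `Kf` and `Kg` may be
  -- null.
  obtain ⟨K₁, hK₁, h1K₁⟩ := exists_compact_mem_nhds (1 : G)
  set K := Kf ∪ Kg ∪ K₁ with hK
  have hKc : IsCompact K := (hKf.union hKg).union hK₁
  obtain ⟨E, n, hEm, hEK, hEμ, hn, hφ, hφt⟩ := h K hKc
    ((μ.measure_pos_of_mem_nhds h1K₁).trans_le (measure_mono subset_union_right))
  have hdiff : Tendsto (fun k => μ (K \ E k)) atTop (𝓝 0) := by
    have e : ∀ k, μ (K \ E k) = μ K - μ (E k) := fun k =>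
      measure_sdiff (hEK k) (hEm k).nullMeasurableSet
        ((measure_mono (hEK k)).trans_lt hKc.measure_lt_top).ne
    simp only [e]
    have := ENNReal.Tendsto.sub (tendsto_const_nhds (x := μ K)) hEμ (Or.inl hKc.measure_lt_top.ne)
    rwa [tsub_self] at this
  -- The norms of `p` and `q` will be at most `‖f‖ + ε` and `‖g‖ + ε`; this `c` brings both `T^n p`
  -- and the preimage of `q` within `ε`.
  obtain ⟨c, hc, hcf, hcg⟩ : ∃ c > 0, c * (‖f‖ + ε) ≤ ε ∧ c * (‖g‖ + ε) ≤ ε := by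
    refine ⟨ε / (‖f‖ + ‖g‖ + ε), by positivity, ?_, ?_⟩ <;>
    · rw [div_mul_eq_mul_div, div_le_iff₀ (by positivity)]
      gcongr
      linarith [norm_nonneg f, norm_nonneg g]
  have hc' : (0 : ℝ≥0∞) < ENNReal.ofReal c := ENNReal.ofReal_pos.2 hc
  obtain ⟨k, hkf, hkg, hk1, hkφ, hkφt⟩ :=
    ((hdiff.eventually_le_const hrf).and ((hdiff.eventually_le_const hrg).and
      ((hn.tendsto_atTop.eventually_ge_atTop 1).and ((hφ.eventually_le_const hc').and
        (hφt.eventually_le_const hc'))))).exists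
  obtain ⟨p, hpE, hp⟩ := hf' (E k) (hEm k) ((measure_mono (sdiff_subset_sdiff_left
    (subset_union_left.trans subset_union_left))).trans hkf)
  obtain ⟨q, hqE, hq⟩ := hg' (E k) (hEm k) ((measure_mono (sdiff_subset_sdiff_left
    (subset_union_right.trans subset_union_left))).trans hkg)
  have hTp := norm_weightedTranslation_iterate_le hw hc hpE
    fun x hx => le_of_supNormOn_le hc.le hkφ hx
  obtain ⟨s, hTs, hs⟩ := exists_weightedTranslation_iterate_eq hw hc hqE
    fun x hx => le_of_supNormOn_le hc.le hkφt hx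
  have hp' : ‖p‖ ≤ ‖f‖ + ε := by
    linarith [norm_sub_norm_le p f, norm_sub_rev p f]
  have hq' : ‖q‖ ≤ ‖g‖ + ε := by
    linarith [norm_sub_norm_le q g, norm_sub_rev q g]
  refine ⟨n k, hk1, _, ⟨p + s, hεU ?_, rfl⟩, hεV ?_⟩
  · rw [Metric.mem_ball, dist_comm, dist_eq_norm]
    calc ‖f - (p + s)‖ = ‖(f - p) - s‖ := by rw [sub_sub]
      _ ≤ ‖f - p‖ + ‖s‖ := norm_sub_le _ _
      _ ≤ ε + ε := add_le_add hp (hs.trans ((by gcongr : _ ≤ c * (‖g‖ + ε)).trans hcg))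
      _ < ε₁ := by linarith [min_le_left ε₁ ε₂]
  · rw [Metric.mem_ball, dist_comm, dist_eq_norm, iterate_map_add, hTs]
    calc _ = ‖(g - q) - (weightedTranslation Φ μ a w hw)^[n k] p‖ := by rw [sub_sub, add_comm q]
      _ ≤ ‖g - q‖ + ‖(weightedTranslation Φ μ a w hw)^[n k] p‖ := norm_sub_le _ _
      _ ≤ ε + ε := add_le_add hq (hTp.trans ((by gcongr : _ ≤ c * (‖f‖ + ε)).trans hcf))
      _ < ε₂ := by linarith [min_le_right ε₁ ε₂]

theorem exists_subset_weightProd_le_of_isRecurrentMap [IsFiniteMeasureOnCompacts μ]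
    (ha : IsAperiodic a) (hw : IsWeight w)
    (hrec : IsRecurrentMap (weightedTranslation Φ μ a w hw)) {K : Set G} (hK : IsCompact K)
    {ε : ℝ} (hε : 0 < ε) (N : ℕ) :
    ∃ n ≥ N, ∃ E ⊆ K, MeasurableSet E ∧ μ K ≤ μ E + ENNReal.ofReal ε ∧
      ∀ x ∈ E, weightProd w a n x ≤ ε ∧ weightProdTilde w a n x ≤ ε := by
  -- `η ≤ 1 / 2` keeps values within `η` of 1 above `1 / 2` in modulus; the weight products then
  -- come out below `2 * η ≤ ε`.
  obtain ⟨η, hη, hη2, hηε⟩ : ∃ η > 0, η ≤ 1 / 2 ∧ 2 * η ≤ ε :=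
    ⟨min (1 / 2) (ε / 2), by positivity, min_le_left _ _, by
      linarith [min_le_right (1 / 2) (ε / 2)]⟩
  -- Four exceptional sets of measure at most `ε / 4` will be discarded: those of `f` and of `T^n
  -- f`, and a translate of each.
  obtain ⟨δ, hδ, hδμ⟩ :=
    exists_luxemburgNorm_lt_imp_meas_le Φ μ hη (by positivity : 0 < ε / 4)
  obtain ⟨N', hN'⟩ := ha.exists_forall_mul_pow_notMem hK
  set χ : G → ℂ := K.indicator fun _ => 1 with hχ
  have hχm : Measurable χ := measurable_const.indicator hK.measurableSet
  have hχo : MemOrlicz Φ μ χ := memOrlicz_of_bound (A := K) (C := 1)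
    (fun x => (norm_indicator_le_norm_self _ _).trans (by simp))
    (fun x hx => indicator_of_notMem hx _) hK.measure_lt_top
  obtain ⟨n, hn, f, hf, hTf⟩ := hrec.exists_ge (weightedTranslation Φ μ a w hw).continuous
    (max N N') Metric.isOpen_ball
    (Metric.nonempty_ball.2 hδ : (Metric.ball (.mk χ hχm.aestronglyMeasurable hχo) δ).Nonempty)
  set g := (weightedTranslation Φ μ a w hw)^[n] f with hg
  have hclose : ∀ u : OrliczSpace Φ μ, u ∈ Metric.ball (.mk χ hχm.aestronglyMeasurable hχo) δ →
      MeasurableSet {x | η ≤ ‖u.val x - χ x‖} ∧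
        μ {x | η ≤ ‖u.val x - χ x‖} ≤ ENNReal.ofReal (ε / 4) := by
    intro u hu
    have hum : Measurable fun x => u.val x - χ x := u.val.stronglyMeasurable.measurable.sub hχm
    have hae : (u - .mk χ hχm.aestronglyMeasurable hχo).val =ᵐ[μ] fun x => u.val x - χ x := by
      filter_upwards [OrliczSpace.val_sub u (.mk χ hχm.aestronglyMeasurable hχo),
        OrliczSpace.val_mk χ hχm.aestronglyMeasurable hχo] with x h1 h2
      rw [h1, Pi.sub_apply, h2]
    refine ⟨measurableSet_le measurable_const hum.norm, hδμ _ hum.aestronglyMeasurable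
      ((OrliczSpace.memOrlicz _).congr hae) ?_⟩
    rw [← luxemburgNorm_congr Φ hae, ← OrliczSpace.norm_def, ← dist_eq_norm]
    exact hu
  obtain ⟨hBm, hBμ⟩ := hclose f hf
  obtain ⟨hDm, hDμ⟩ := hclose g hTf
  set B := {x | η ≤ ‖f.val x - χ x‖} with hB
  set D := {x | η ≤ ‖g.val x - χ x‖} with hD
  set R := {x | ¬ g.val x = ((weightProdTilde w a n x)⁻¹ : ℝ) * f.val (x * (a ^ n)⁻¹)} with hR
  have hR0 : μ R = 0 := ae_iff.1 (weightedTranslation_iterate_val hw n f)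
  have hRm : MeasurableSet R := by
    refine (measurableSet_eq_fun g.val.stronglyMeasurable.measurable (Measurable.mul ?_ ?_)).compl
    · exact Complex.measurable_ofReal.comp (hw.continuous_weightProdTilde a n).measurable.inv
    · exact f.val.stronglyMeasurable.measurable.comp (measurable_mul_const _)
  -- Off `Z`, `f` is controlled at `x` and `x a⁻ⁿ`, `T^n f` at `x` and `x aⁿ`, and the iterate
  -- formula, valid only almost everywhere, holds at `x` and `x aⁿ`. Right invariance gives each
  -- translate the measure of the original set.
  set Z := (B ∪ (fun x => x * (a ^ n)⁻¹) ⁻¹' B) ∪ (D ∪ (fun x => x * a ^ n) ⁻¹' D) ∪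
    (R ∪ (fun x => x * a ^ n) ⁻¹' R) with hZ
  have hZm : MeasurableSet Z :=
    ((hBm.union (hBm.preimage (measurable_mul_const _))).union
      (hDm.union (hDm.preimage (measurable_mul_const _)))).union
      (hRm.union (hRm.preimage (measurable_mul_const _)))
  have hZμ : μ Z ≤ ENNReal.ofReal ε := by
    calc μ Z ≤ (μ B + μ B) + (μ D + μ D) + (μ R + μ R) := by
          refine (measure_union_le _ _).trans (add_le_add ((measure_union_le _ _).trans
            (add_le_add ?_ ?_)) ?_) <;>
          · refine (measure_union_le _ _).trans_eq ?_
            rw [measure_preimage_mul_right]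
      _ ≤ ENNReal.ofReal (ε / 4) + ENNReal.ofReal (ε / 4) +
          (ENNReal.ofReal (ε / 4) + ENNReal.ofReal (ε / 4)) + (0 + 0) := by
        rw [hR0]; gcongr
      _ = ENNReal.ofReal ε := by
        rw [add_zero, add_zero, ← ENNReal.ofReal_add (by positivity) (by positivity),
          ← ENNReal.ofReal_add (by positivity) (by positivity)]
        congr 1; ring
  refine ⟨n, (le_max_left _ _).trans hn, K \ Z, sdiff_subset, hK.measurableSet.diff hZm, ?_, ?_⟩
  · calc μ K ≤ μ ((K \ Z) ∪ Z) := measure_mono (by rw [sdiff_union_self]; exact subset_union_left)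
      _ ≤ μ (K \ Z) + μ Z := measure_union_le _ _
      _ ≤ _ := by gcongr
  rintro x ⟨hxK, hxZ⟩
  simp only [hZ, hB, hD, hR, mem_union, mem_preimage, mem_ofPred_eq, not_or, not_le, not_not]
    at hxZ
  obtain ⟨⟨⟨hB1, hB2⟩, hD1, hD2⟩, hR1, hR2⟩ := hxZ
  have hout : x * a ^ n ∉ K := hN' n ((le_max_right _ _).trans hn) x hxK
  have hout' : x * (a ^ n)⁻¹ ∉ K := fun h =>
    hN' n ((le_max_right _ _).trans hn) _ h (by rwa [inv_mul_cancel_right])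
  rw [hχ, indicator_of_mem hxK] at hB1 hD1
  rw [hχ, indicator_of_notMem hout', sub_zero] at hB2
  rw [hχ, indicator_of_notMem hout, sub_zero] at hD2
  have half_lt : ∀ z : ℂ, ‖z - 1‖ < η → 1 / 2 < ‖z‖ := by
    intro z hz
    have := norm_sub_norm_le 1 z
    rw [norm_one, norm_sub_rev] at this
    linarith
  -- From `|q| = |p| / t > 1 / 2` and `|p| < η` follows `t < 2 * η ≤ ε`. It is applied with `t = φ_n
  -- x` across `x` and `x aⁿ`, and with `t = φ̃_n x` across `x a⁻ⁿ` and `x`.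
  have key : ∀ {p q : ℂ} {t : ℝ}, 0 < t → q = (t⁻¹ : ℝ) * p → 1 / 2 < ‖q‖ → ‖p‖ < η → t ≤ ε := by
    intro p q t ht hq hq2 hp
    rw [hq, norm_mul, Complex.norm_real, Real.norm_of_nonneg (by positivity), inv_mul_eq_div,
      lt_div_iff₀ ht] at hq2
    linarith
  constructor
  · refine key (p := g.val (x * a ^ n)) (q := f.val x) (hw.weightProd_pos a n x) ?_
      (half_lt _ hB1) hD2
    have hne : (weightProd w a n x : ℂ) ≠ 0 := by exact_mod_cast (hw.weightProd_pos a n x).ne'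
    rw [hR2, weightProdTilde_mul_pow, inv_inv, mul_inv_cancel_right, Complex.ofReal_inv,
      inv_mul_cancel_left₀ hne]
  · exact key (hw.weightProdTilde_pos a n x) hR1 (half_lt _ hD1) hB2

theorem exists_seq_tendsto_supNormOn_of_isRecurrentMap [IsFiniteMeasureOnCompacts μ]
    (ha : IsAperiodic a) (hw : IsWeight w)
    (hrec : IsRecurrentMap (weightedTranslation Φ μ a w hw)) {K : Set G} (hK : IsCompact K) :
    ∃ (E : ℕ → Set G) (n : ℕ → ℕ), (∀ k, MeasurableSet (E k)) ∧ (∀ k, E k ⊆ K) ∧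
      Tendsto (fun k => μ (E k)) atTop (𝓝 (μ K)) ∧ StrictMono n ∧
      Tendsto (fun k => supNormOn (weightProd w a (n k)) (E k)) atTop (𝓝 0) ∧
      Tendsto (fun k => supNormOn (weightProdTilde w a (n k)) (E k)) atTop (𝓝 0) := by
  have hpos : ∀ k : ℕ, (0 : ℝ) < 1 / (k + 1) := fun k => by positivity
  -- For each tolerance `1 / (k + 1)` the admissible exponents are unbounded, so they can be chosen
  -- strictly increasing in `k`.
  obtain ⟨n, hn, h⟩ := extraction_forall_of_frequently fun k : ℕ => frequently_atTop.2 fun N =>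
    exists_subset_weightProd_le_of_isRecurrentMap ha hw hrec hK (hpos k) N
  choose E hEK hEm hEμ hE using h
  have h0 : Tendsto (fun k : ℕ => ENNReal.ofReal (1 / ((k : ℝ) + 1))) atTop (𝓝 0) := by
    simpa using ENNReal.tendsto_ofReal (tendsto_one_div_add_atTop_nhds_zero_nat (𝕜 := ℝ))
  refine ⟨E, n, hEm, hEK, ?_, hn, ?_, ?_⟩
  · refine tendsto_of_tendsto_of_tendsto_of_le_of_le (g := fun k : ℕ =>
      μ K - ENNReal.ofReal (1 / ((k : ℝ) + 1))) ?_ tendsto_const_nhds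
      (fun k => tsub_le_iff_right.2 (hEμ k)) fun k => measure_mono (hEK k)
    simpa only [tsub_zero] using ENNReal.Tendsto.sub (tendsto_const_nhds (x := μ K)) h0
      (Or.inl hK.measure_lt_top.ne)
  · exact tendsto_of_tendsto_of_tendsto_of_le_of_le tendsto_const_nhds h0 (fun _ => zero_le)
      fun k => supNormOn_le fun x hx => ⟨(hw.weightProd_pos a _ x).le, (hE k x hx).1⟩
  · exact tendsto_of_tendsto_of_tendsto_of_le_of_le tendsto_const_nhds h0 (fun _ => zero_le)
      fun k => supNormOn_le fun x hx => ⟨(hw.weightProdTilde_pos a _ x).le, (hE k x hx).2⟩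

end Main

end

theorem corollary2p4 {G : Type*} [Group G] [TopologicalSpace G] [IsTopologicalGroup G]
    [LocallyCompactSpace G] [T2Space G] [SecondCountableTopology G]
    [MeasurableSpace G] [BorelSpace G]
    (μ : Measure G) [μ.IsMulRightInvariant] [μ.IsOpenPosMeasure] [μ.Regular]
    (Φ : YoungFunction) (hΦ : Φ.IsDelta2Regular G)
    (a : G) (ha : IsAperiodic a)
    (w : G → ℝ) (hw : IsWeight w) (hw_inv : MemLp (fun x => (w x)⁻¹) ∞ μ) :
    (IsRecurrentMap (weightedTranslation Φ μ a w hw) ↔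
      ∀ K : Set G, IsCompact K → 0 < μ K →
        ∃ (E : ℕ → Set G) (n : ℕ → ℕ),
          (∀ k, MeasurableSet (E k)) ∧ (∀ k, E k ⊆ K) ∧
          Tendsto (fun k => μ (E k)) atTop (𝓝 (μ K)) ∧
          StrictMono n ∧
          Tendsto (fun k => supNormOn (weightProd w a (n k)) (E k)) atTop (𝓝 0) ∧
          Tendsto (fun k => supNormOn (weightProdTilde w a (n k)) (E k)) atTop (𝓝 0)) ∧
    (IsRecurrentMap (weightedTranslation Φ μ a w hw) ↔
      IsTransitiveMap (weightedTranslation Φ μ a w hw)) := by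
  -- An aperiodic element forces `G` to be noncompact, so `Δ₂`-regularity supplies the doubling
  -- inequality for all `t > 0`.
  have := ha.noncompactSpace
  obtain ⟨M, hM, hMΦ⟩ := hΦ.2 this
  have h₁ := fun hrec : IsRecurrentMap (weightedTranslation Φ μ a w hw) =>
    fun (K : Set G) (hK : IsCompact K) (_ : 0 < μ K) =>
      exists_seq_tendsto_supNormOn_of_isRecurrentMap ha hw hrec hK
  have h₂ := isTransitiveMap_weightedTranslation (μ := μ) (a := a) hM hMΦ hw
  exact ⟨⟨h₁, fun h => (h₂ h).isRecurrentMap⟩, fun hrec => h₂ (h₁ hrec),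
    IsTransitiveMap.isRecurrentMap⟩
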